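/- Let $p$ be a prime, let $n\ge 1$, and regard $\mathrm{GF}(p)$ as the prime field of $\mathrm{GF}(p^n)$. A function $g:\mathrm{GF}(p^n)^*\to \mathrm{GF}(p)$ is called balanced if it takes the value $0$ exactly $p^{n-1}-1$ times and each nonzero value of $\mathrm{GF}(p)$ exactly $p^{n-1}$ times. A function $f:\mathrm{GF}(p^n)^*\to \mathrm{GF}(p)$ is called difference balanced if, for each $a\in \mathrm{GF}(p^n)^*\setminus\{1\}$, the function $x\mapsto f(ax)-f(x)$ is balanced. For an integer $d$, a function $g:\mathrm{GF}(p^n)^*\to \mathrm{GF}(p)$ is called $d$-homogeneous if $\gcd(d,p-1)=1$ and $g(ax)=a^d g(x)$ for all $a\in \mathrm{GF}(p)^*$ and all $x\in \mathrm{GF}(p^n)^*$. Let $f:\mathrm{GF}(p^n)^*\to \mathrm{GF}(p)$ be difference balanced. If $f$ is balanced, then $f$ is $d$-homogeneous for some integer $d$. In general, there is $b\in \mathrm{GF}(p)$ such that $f-b$ is balanced and $f-b$ is $d$-homogeneous for some integer $d$. -/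

import Mathlib

/-- A function `f` from the multiplicative group of `K = GF(q^n)` to `F = GF(q)` is balanced
if it takes the value `0` exactly `q^(n-1) - 1` times and every nonzero value exactly
`q^(n-1)` times. -/
def IsBalanced {F K : Type*} [Field F] [Field K] (n : ℕ) (f : Kˣ → F) : Prop :=
  Nat.card {x : Kˣ // f x = 0} = Nat.card F ^ (n - 1) - 1 ∧
    ∀ b : F, b ≠ 0 → Nat.card {x : Kˣ // f x = b} = Nat.card F ^ (n - 1)

/-- `f` is difference balanced if `x ↦ f (a x) - f x` is balanced for every `a ≠ 1`. -/
def IsDifferenceBalanced {F K : Type*} [Field F] [Field K] (n : ℕ) (f : Kˣ → F) : Prop :=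
  ∀ a : Kˣ, a ≠ 1 → IsBalanced n (fun x : Kˣ => f (a * x) - f x)

/-- `f` is `d`-homogeneous: `gcd(d, q - 1) = 1` and `f (a x) = a^d f x` for all nonzero
`a` in `F = GF(q)` and all nonzero `x` in `K`. -/
def IsHomogeneousOfDegree {F K : Type*} [Field F] [Field K] [Algebra F K]
    (d : ℤ) (f : Kˣ → F) : Prop :=
  Int.gcd d ((Nat.card F : ℤ) - 1) = 1 ∧
    ∀ (a : Fˣ) (x : Kˣ),
      f (Units.map (algebraMap F K : F →* K) a * x) = (a : F) ^ d * f x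

/-!
Let `f` be balanced and difference balanced, let `W` be the ring of Witt vectors of `K`, let `ζ` be
a formal primitive `p`-th root of unity over `W`, and let `e c = ζ ^ c`. By difference balance the
autocorrelation of `e ∘ f` is two-valued, so for every nontrivial character `χ` of `Kˣ` the
transforms of `e ∘ f` at `χ` and of `e ∘ (-f)` at `χ⁻¹` have product `|K|`. In `W[ζ]` the only prime
dividing `p` is `ζ - 1`, which divides its image under `σ : ζ ↦ ζ ^ t`; hence each transform divides
its image under `σ`. Therefore `|K|` divides the transforms of `C`, the correlation of `e ∘ (t f)`
with `e ∘ (-f)`, and Fourier inversion gives `C a ≡ -1` modulo `|K|`. Comparing the coefficients of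
the powers of `ζ` modulo `|K|`, either `x ↦ t f (a x) - f x` is balanced, so that `C a = -1`, or it
vanishes identically; since the sum of `C` is `1`, the latter occurs for some `a`. Comparing roots
of unity in `K` then turns the multipliers of `f` into homogeneity.

In general the fibre sizes of `f` have known sum and sum of squares, and these leave room for a
single deviation from uniformity, whose position is the translate `b`.
-/

section PrimeCyclotomicRing

open Polynomial

theorem pow_dvd_intCast_iff {W : Type*} [CommRing W] [IsDomain W] {p : ℕ} [Fact p.Prime]
    (hpW : Prime (p : W)) {n : ℕ} {k : ℤ} : (p : W) ^ n ∣ k ↔ (p : ℤ) ^ n ∣ k := by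
  refine ⟨fun h => ?_, fun h => by exact_mod_cast Int.cast_dvd_cast (α := W) _ _ h⟩
  induction n generalizing k with
  | zero => simp
  | succ n ih =>
    have hpk : (p : ℤ) ∣ k := by
      by_contra hpk
      have hp : Prime (p : ℤ) := Nat.prime_iff_prime_int.1 Fact.out
      have hcop : IsCoprime (p : W) k := by
        simpa using ((hp.coprime_iff_not_dvd).2 hpk).intCast (R := W)
      exact hpW.not_isUnit (hcop.isUnit_of_dvd ((dvd_pow_self _ n.succ_ne_zero).trans h))
    obtain ⟨k, rfl⟩ := hpk
    rw [pow_succ', Int.cast_mul, Int.cast_natCast, mul_dvd_mul_iff_left hpW.ne_zero] at h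
    exact pow_succ' (p : ℤ) n ▸ mul_dvd_mul_left (p : ℤ) (ih h)

theorem irreducible_cyclotomic_of_prime_natCast {W : Type*} [CommRing W] [IsDomain W] {p : ℕ}
    [Fact p.Prime] (hpW : Prime (p : W)) : Irreducible (cyclotomic p W) := by
  rw [← MulEquiv.irreducible_iff (taylorEquiv (1 : W))]
  change Irreducible (taylor 1 (cyclotomic p W))
  set f := taylor (1 : W) (cyclotomic p W) with hf
  have hmonic : f.Monic := (leadingCoeff_taylor 1 _).trans (cyclotomic.monic p W)
  have hdeg : 0 < f.natDegree := by
    rw [natDegree_taylor]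
    exact natDegree_pos_iff_degree_pos.2 (degree_cyclotomic_pos p W (NeZero.pos p))
  have hprime : (Ideal.span {(p : W)}).IsPrime := (Ideal.span_singleton_prime hpW.ne_zero).2 hpW
  have hweak : f.IsWeaklyEisensteinAt (Ideal.span {(p : W)}) := by
    simpa [hf, taylor_apply, Polynomial.map_comp, Ideal.map_span] using
      (cyclotomic_comp_X_add_one_isEisensteinAt p).isWeaklyEisensteinAt.map (Int.castRingHom W)
  refine (hmonic.isEisensteinAt_of_mem_of_notMem hprime.ne_top hweak.mem ?_).irreducible hprime
    hmonic.isPrimitive hdeg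
  have hcoeff : f.coeff 0 = p := by simp [hf, taylor_coeff_zero]
  rw [hcoeff, Ideal.span_singleton_pow, Ideal.mem_span_singleton, sq]
  intro h
  exact hpW.not_isUnit (isUnit_of_dvd_one ((mul_dvd_mul_iff_left hpW.ne_zero).1 (by simpa using h)))

/-- The ring `W[ζ]` obtained by adjoining to `W` a formal root `ζ` of the `p`-th cyclotomic
polynomial. It is used for an unramified extension `W` of the `p`-adic integers, where `p` is
totally ramified in `W[ζ]` with uniformizer `ζ - 1`. -/
abbrev PrimeCyclotomicRing (p : ℕ) (W : Type*) [CommRing W] : Type _ :=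
  AdjoinRoot (cyclotomic p W)

namespace PrimeCyclotomicRing

variable {p : ℕ} {W : Type*} [CommRing W]

local notation "ζ" => AdjoinRoot.root (cyclotomic p W)

theorem root_pow_eq_one : ζ ^ p = 1 := by
  have := (AdjoinRoot.mk_eq_zero (f := cyclotomic p W)).2 (cyclotomic.dvd_X_pow_sub_one p W)
  simpa [sub_eq_zero] using this

variable [Fact p.Prime]

theorem isDomain [IsDomain W] [UniqueFactorizationMonoid W] (hpW : Prime (p : W)) :
    IsDomain (PrimeCyclotomicRing p W) :=
  AdjoinRoot.isDomain_of_prime (irreducible_cyclotomic_of_prime_natCast hpW).prime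

theorem of_injective [IsDomain W] :
    Function.Injective (AdjoinRoot.of (cyclotomic p W)) :=
  AdjoinRoot.of.injective_of_degree_ne_zero (degree_cyclotomic_pos p W (NeZero.pos p)).ne'

theorem natCast_ne_zero [IsDomain W] (hpW : (p : W) ≠ 0) :
    (p : PrimeCyclotomicRing p W) ≠ 0 := by
  rwa [← map_natCast (AdjoinRoot.of (cyclotomic p W)), Ne, map_eq_zero_iff _ of_injective]

theorem root_sub_one_dvd_mk_iff {g : W[X]} :
    ζ - 1 ∣ AdjoinRoot.mk (cyclotomic p W) g ↔ (p : W) ∣ g.eval 1 := by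
  have hmk (h : W[X]) : ζ - 1 ∣ AdjoinRoot.mk (cyclotomic p W) h - AdjoinRoot.of _ (h.eval 1) := by
    have := map_dvd (AdjoinRoot.mk (cyclotomic p W)) (X_sub_C_dvd_sub_C_eval (a := 1) (p := h))
    simpa using this
  have hp : ζ - 1 ∣ (p : PrimeCyclotomicRing p W) := by simpa using hmk (cyclotomic p W)
  constructor
  · rintro ⟨y, hy⟩
    obtain ⟨h, rfl⟩ := AdjoinRoot.mk_surjective y
    have hmod : cyclotomic p W ∣ g - (X - 1) * h := by
      rw [← AdjoinRoot.mk_eq_mk, hy]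
      simp
    have := eval_dvd (x := 1) hmod
    simpa using this
  · intro h
    have hmap := map_dvd (AdjoinRoot.of (cyclotomic p W)) h
    rw [map_natCast] at hmap
    exact (dvd_iff_dvd_of_dvd_sub (hmk g)).2 (hp.trans hmap)

theorem prime_root_sub_one [IsDomain W] (hpW : Prime (p : W)) : Prime (ζ - 1) := by
  refine ⟨fun h => ?_, fun h => ?_, fun x y hxy => ?_⟩
  · have hp := root_sub_one_dvd_mk_iff.2 (by simp : (p : W) ∣ (p : W[X]).eval 1)
    rw [h, zero_dvd_iff, map_natCast] at hp
    exact natCast_ne_zero hpW.ne_zero hp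
  · have := root_sub_one_dvd_mk_iff.1 (h.dvd (a := AdjoinRoot.mk _ 1))
    exact hpW.not_isUnit (isUnit_of_dvd_one (by simpa using this))
  · obtain ⟨g, rfl⟩ := AdjoinRoot.mk_surjective x
    obtain ⟨h, rfl⟩ := AdjoinRoot.mk_surjective y
    rw [← map_mul] at hxy
    simp only [root_sub_one_dvd_mk_iff, eval_mul] at hxy ⊢
    exact hpW.dvd_or_dvd hxy

theorem isPrimitiveRoot_root [IsDomain W] [UniqueFactorizationMonoid W] (hpW : Prime (p : W)) :
    IsPrimitiveRoot ζ p := by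
  have := isDomain hpW
  have : NeZero (p : PrimeCyclotomicRing p W) := ⟨natCast_ne_zero hpW.ne_zero⟩
  rw [← isRoot_cyclotomic_iff, ← map_cyclotomic p (AdjoinRoot.of (cyclotomic p W))]
  exact AdjoinRoot.isRoot_root _

theorem exists_algHom_root_eq_pow [IsDomain W] [UniqueFactorizationMonoid W]
    (hpW : Prime (p : W)) {t : ℕ} (ht : t.Coprime p) :
    ∃ σ : PrimeCyclotomicRing p W →ₐ[W] PrimeCyclotomicRing p W, σ ζ = ζ ^ t := by
  have := isDomain hpW
  have hroot : (cyclotomic p (PrimeCyclotomicRing p W)).IsRoot (ζ ^ t) :=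
    ((isPrimitiveRoot_root hpW).pow_of_coprime t ht).isRoot_cyclotomic (NeZero.pos p)
  refine ⟨AdjoinRoot.liftAlgHom _ (Algebra.ofId _ _) (ζ ^ t) ?_, AdjoinRoot.liftAlgHom_root _ _ _ _⟩
  rw [← eval_map, map_cyclotomic]
  exact hroot

variable (p W) in
/-- The additive character `c ↦ ζ ^ c` of the prime field with values in `W[ζ]`. -/
noncomputable def addChar : AddChar (ZMod p) (PrimeCyclotomicRing p W) :=
  AddChar.zmodChar p root_pow_eq_one

theorem addChar_natCast (k : ℕ) : addChar p W k = ζ ^ k :=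
  AddChar.zmodChar_apply' _ k

theorem addChar_apply (c : ZMod p) : addChar p W c = ζ ^ c.val :=
  AddChar.zmodChar_apply _ c

theorem addChar_ne_one [IsDomain W] [UniqueFactorizationMonoid W] (hpW : Prime (p : W)) :
    addChar p W ≠ 1 := by
  rw [← AddChar.mulShift_one (addChar p W)]
  exact AddChar.zmodChar_primitive_of_primitive_root p (isPrimitiveRoot_root hpW) one_ne_zero

theorem exists_algHom_addChar_mul [IsDomain W] [UniqueFactorizationMonoid W]
    (hpW : Prime (p : W)) (t : (ZMod p)ˣ) :
    ∃ σ : PrimeCyclotomicRing p W →ₐ[W] PrimeCyclotomicRing p W,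
      ζ - 1 ∣ σ (ζ - 1) ∧ ∀ c, σ (addChar p W c) = addChar p W (t * c) := by
  obtain ⟨σ, hσ⟩ := exists_algHom_root_eq_pow hpW (ZMod.val_coe_unit_coprime t)
  refine ⟨σ, ?_, fun c => ?_⟩
  · rw [map_sub, map_one, hσ]
    exact sub_one_dvd_pow_sub_one _ _
  · have hmul : (t : ZMod p) * c = ((t : ZMod p).val * c.val : ℕ) := by simp
    rw [hmul, addChar_natCast, addChar_apply, map_pow, hσ, pow_mul]

theorem coeff_eq_of_cyclotomic_dvd {A : Type*} [CommRing A] {g : A[X]} (hdeg : g.natDegree < p)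
    (hdvd : cyclotomic p A ∣ g) {i j : ℕ} (hi : i < p) (hj : j < p) : g.coeff i = g.coeff j := by
  nontriviality A
  obtain ⟨h, rfl⟩ := hdvd
  obtain rfl | hh := eq_or_ne h 0
  · simp
  have hconst : h = C (h.coeff 0) := by
    refine eq_C_of_natDegree_le_zero ?_
    rw [(cyclotomic.monic p A).natDegree_mul' hh, natDegree_cyclotomic,
      Nat.totient_prime Fact.out] at hdeg
    omega
  rw [hconst, cyclotomic_prime]
  simp [coeff_X_pow, hi, hj]

theorem dvd_sub_of_dvd_sum_mul_addChar {q : W} {m : ZMod p → W}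
    (h : AdjoinRoot.of (cyclotomic p W) q ∣ ∑ c, AdjoinRoot.of _ (m c) * addChar p W c)
    (c d : ZMod p) : q ∣ m c - m d := by
  let g : W[X] := ∑ c, C (m c) * X ^ c.val
  have hcoeff (c : ZMod p) : g.coeff c.val = m c := by
    simp [g, coeff_X_pow, (ZMod.val_injective p).eq_iff]
  have hdeg : g.natDegree ≤ p - 1 :=
    natDegree_sum_le_of_forall_le _ _ fun c _ =>
      (natDegree_C_mul_X_pow_le _ _).trans (Nat.le_sub_one_of_lt (ZMod.val_lt c))
  obtain ⟨y, hy⟩ := h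
  obtain ⟨k, rfl⟩ := AdjoinRoot.mk_surjective y
  have hdvd : cyclotomic p W ∣ g - C q * k := by
    rw [← AdjoinRoot.mk_eq_mk]
    simpa [g, addChar_apply] using hy
  let π := Ideal.Quotient.mk (Ideal.span {q})
  have hmod : cyclotomic p (W ⧸ Ideal.span {q}) ∣ g.map π := by
    have := map_dvd (mapRingHom π) hdvd
    have hq : π q = 0 := Ideal.Quotient.eq_zero_iff_mem.2 (Ideal.mem_span_singleton_self q)
    simpa [hq] using this
  have hpos : p - 1 < p := Nat.sub_one_lt (NeZero.ne p)
  have heq := coeff_eq_of_cyclotomic_dvd ((natDegree_map_le.trans hdeg).trans_lt hpos) hmod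
    (ZMod.val_lt c) (ZMod.val_lt d)
  rwa [coeff_map, coeff_map, hcoeff, hcoeff, Ideal.Quotient.mk_eq_mk_iff_sub_mem,
    Ideal.mem_span_singleton] at heq

end PrimeCyclotomicRing

theorem natCast_dvd_sub_one_pow {R : Type*} [CommRing R] {p : ℕ} (hp : p.Prime) {z : R}
    (hz : z ^ p = 1) : (p : R) ∣ (z - 1) ^ p := by
  obtain ⟨r, hr⟩ := exists_add_pow_prime_eq hp (z - 1) 1
  refine ⟨-((z - 1) * r), ?_⟩
  rw [sub_add_cancel, hz] at hr
  linear_combination -hr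

theorem dvd_map_of_dvd_prime_pow {R : Type*} [CommRing R] [IsDomain R] {π : R} (hπ : Prime π)
    {σ : R →+* R} (hσ : π ∣ σ π) {x : R} {m : ℕ} (hx : x ∣ π ^ m) : x ∣ σ x := by
  obtain ⟨i, -, hi⟩ := (dvd_prime_pow hπ m).1 hx
  have h : π ^ i ∣ σ (π ^ i) := map_pow σ π i ▸ pow_dvd_pow_of_dvd hσ i
  exact hi.dvd.trans (h.trans (map_dvd σ hi.symm.dvd))

end PrimeCyclotomicRing

section CharacterTransform

variable {G R : Type*} [CommGroup G] [Fintype G] [CommRing R]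

/-- The Fourier transform of `u` on the finite abelian group `G`, at the `R`-valued character
`χ`. -/
def charTransform (χ : G →* R) (u : G → R) : R :=
  ∑ x, χ x * u x

/-- The periodic correlation of `u` and `v` on the finite group `G`, at the shift `a`. -/
def correlation (u v : G → R) (a : G) : R :=
  ∑ x, u (a * x) * v x

theorem charTransform_correlation (χ : G →* R) (u v : G → R) :
    charTransform χ (correlation u v) =
      charTransform χ u * charTransform (χ.comp invMonoidHom) v := by
  have hshift (x : G) :
      ∑ a, χ a * (u (a * x) * v x) = charTransform χ u * (χ x⁻¹ * v x) := by
    rw [charTransform, ← Equiv.sum_comp (Equiv.mulRight x) fun y => χ y * u y, Finset.sum_mul]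
    refine Finset.sum_congr rfl fun a _ => ?_
    have hχ : χ a = χ (a * x) * χ x⁻¹ := by rw [← map_mul, mul_inv_cancel_right]
    simp only [hχ, Equiv.coe_mulRight]
    ring
  calc charTransform χ (correlation u v)
      = ∑ x, ∑ a, χ a * (u (a * x) * v x) := by
        simp only [charTransform, correlation, Finset.mul_sum]
        exact Finset.sum_comm
    _ = charTransform χ u * charTransform (χ.comp invMonoidHom) v := by
        simp only [hshift, ← Finset.mul_sum]
        rfl

theorem charTransform_add_one [IsDomain R] {χ : G →* R} (hχ : χ ≠ 1) (u : G → R) :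
    charTransform χ (fun x => u x + 1) = charTransform χ u := by
  simp only [charTransform, mul_add, mul_one, Finset.sum_add_distrib,
    sum_hom_units_eq_zero χ hχ, add_zero]

theorem sum_range_pow_eq_ite [IsDomain R] [DecidableEq G] {θ : G →* R}
    (hθ : Function.Injective θ) (x : G) :
    ∑ j ∈ Finset.range (Fintype.card G), (θ ^ j) x =
      if x = 1 then (Fintype.card G : R) else 0 := by
  simp only [MonoidHom.pow_apply]
  split_ifs with hx
  · simp [hx]
  · have hgeom := geom_sum_mul (θ x) (Fintype.card G)
    rw [← map_pow, pow_card_eq_one, map_one, sub_self] at hgeom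
    refine (mul_eq_zero.1 hgeom).resolve_right fun h => hx (hθ ?_)
    rw [map_one, sub_eq_zero.1 h]

/-- Fourier inversion: an injective `θ` generates the character group. -/
theorem dvd_card_mul_of_dvd_charTransform [IsDomain R] {θ : G →* R} (hθ : Function.Injective θ)
    {d : R} {u : G → R} (hd : ∀ j : ℕ, d ∣ charTransform (θ ^ j) u) (a : G) :
    d ∣ Fintype.card G * u a := by
  classical
  have hinv : ∑ j ∈ Finset.range (Fintype.card G), (θ ^ j) a⁻¹ * charTransform (θ ^ j) u =
      Fintype.card G * u a := by
    simp only [charTransform, Finset.mul_sum, ← mul_assoc, ← map_mul]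
    rw [Finset.sum_comm]
    simp only [← Finset.sum_mul, sum_range_pow_eq_ite hθ, inv_mul_eq_one, ite_mul, zero_mul,
      Finset.sum_ite_eq, Finset.mem_univ, if_true]
  exact hinv ▸ Finset.dvd_sum fun j _ => (hd j).mul_left _

end CharacterTransform

section FiberCount

variable {F K : Type*} [Field F] [Field K]

open scoped Classical in
/-- The number of solutions in `K` of `g x = c`, where `g` is extended to `K` by `g 0 = 0`. -/
noncomputable def fiberCount (g : Kˣ → F) (c : F) : ℕ :=
  Nat.card {x // g x = c} + if c = 0 then 1 else 0

theorem isBalanced_iff_fiberCount [Finite F] {n : ℕ} {g : Kˣ → F} :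
    IsBalanced n g ↔ ∀ c, fiberCount g c = Nat.card F ^ (n - 1) := by
  have hpos : 0 < Nat.card F ^ (n - 1) := pow_pos Nat.card_pos _
  constructor
  · rintro ⟨h0, h1⟩ c
    obtain rfl | hc := eq_or_ne c 0
    · rw [fiberCount, h0, if_pos rfl, Nat.sub_add_cancel hpos]
    · rw [fiberCount, h1 c hc, if_neg hc, add_zero]
  · intro h
    refine ⟨?_, fun c hc => ?_⟩
    · rw [← h 0, fiberCount, if_pos rfl, Nat.add_sub_cancel]
    · rw [← h c, fiberCount, if_neg hc, add_zero]

theorem sum_card_fiber_mul {ι κ R : Type*} [Fintype ι] [Fintype κ] [CommSemiring R] (g : ι → κ)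
    (φ : κ → R) : ∑ c, (Nat.card {x // g x = c} : R) * φ c = ∑ x, φ (g x) := by
  classical
  rw [← Fintype.sum_fiberwise g]
  refine Finset.sum_congr rfl fun c _ => ?_
  rw [Finset.sum_congr rfl fun x _ => congrArg φ x.2]
  simp

theorem sum_fiberCount_mul [Fintype F] [Fintype Kˣ] {R : Type*} [CommSemiring R] (g : Kˣ → F)
    (φ : F → R) : ∑ c, (fiberCount g c : R) * φ c = ∑ x, φ (g x) + φ 0 := by
  simp only [fiberCount, Nat.cast_add, add_mul, Finset.sum_add_distrib, sum_card_fiber_mul]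
  congr 1
  exact (Fintype.sum_eq_single 0 fun c hc => by simp [hc]).trans (by simp)

theorem sum_fiberCount [Fintype F] [Finite K] (g : Kˣ → F) :
    ∑ c, fiberCount g c = Nat.card K := by
  have := Fintype.ofFinite Kˣ
  simpa [Nat.card_eq_card_units_add_one K] using sum_fiberCount_mul (R := ℕ) g fun _ => 1

theorem eq_zero_of_fiberCount_eq_card [Finite K] {g : Kˣ → F} {c : F}
    (h : fiberCount g c = Nat.card K) (x : Kˣ) : g x = 0 := by
  by_contra hx
  rw [fiberCount, Nat.card_eq_card_units_add_one K] at h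
  have hle : Nat.card {x // g x = c} ≤ Nat.card Kˣ := Finite.card_subtype_le _
  split_ifs at h with hc
  · have := Finite.card_subtype_lt (p := fun x => g x = c) (hc ▸ hx)
    omega
  · omega

theorem IsBalanced.sum_addChar [Finite F] [Fintype Kˣ] {R : Type*} [CommRing R] [IsDomain R]
    {n : ℕ} {g : Kˣ → F} (hg : IsBalanced n g) {e : AddChar F R} (he : e ≠ 1) :
    ∑ x, e (g x) = -1 := by
  have := Fintype.ofFinite F
  have h := sum_fiberCount_mul g e
  simp only [isBalanced_iff_fiberCount.1 hg, ← Finset.mul_sum, AddChar.sum_eq_zero_of_ne_one he,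
    mul_zero, AddChar.map_zero_eq_one] at h
  exact (eq_neg_of_add_eq_zero_left h.symm)

end FiberCount

section Correlation

variable {F K R : Type*} [Field F] [Field K] [Fintype Kˣ] [CommRing R]
  {n : ℕ} {f : Kˣ → F} {e : AddChar F R}

theorem correlation_addChar (t : F) (a : Kˣ) :
    correlation (fun x => e (t * f x)) (fun x => e (-f x)) a = ∑ x, e (t * f (a * x) - f x) := by
  simp only [correlation, ← AddChar.map_add_eq_mul, ← sub_eq_add_neg]

variable [Finite F] [IsDomain R]

theorem charTransform_mul_charTransform_inv [Finite K] (hf : IsDifferenceBalanced n f) (he : e ≠ 1)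
    {χ : Kˣ →* R} (hχ : χ ≠ 1) :
    charTransform χ (fun x => e (f x)) *
      charTransform (χ.comp invMonoidHom) (fun x => e (-f x)) = Nat.card K := by
  classical
  have hcorr (a : Kˣ) : correlation (fun x => e (f x)) (fun x => e (-f x)) a + 1 =
      if a = 1 then (Nat.card K : R) else 0 := by
    have h := correlation_addChar (e := e) (f := f) 1 a
    simp only [one_mul] at h
    rw [h]
    split_ifs with ha
    · simp [ha, Nat.card_eq_card_units_add_one K]
    · rw [(hf a ha).sum_addChar he, neg_add_cancel]
  rw [← charTransform_correlation, ← charTransform_add_one hχ]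
  simp [charTransform, hcorr]

variable {t : F}

theorem IsBalanced.sum_correlation (hb : IsBalanced n f) (he : e ≠ 1) (ht : t ≠ 0) :
    ∑ a, correlation (fun x => e (t * f x)) (fun x => e (-f x)) a = 1 := by
  have hsum {r : F} (hr : r ≠ 0) : ∑ x, e (r * f x) = -1 :=
    hb.sum_addChar (AddChar.IsPrimitive.of_ne_one he hr)
  have h := charTransform_correlation 1 (fun x => e (t * f x)) (fun x => e (-f x))
  have hneg := hsum (neg_ne_zero.2 one_ne_zero)
  simp only [neg_one_mul] at hneg
  simpa [charTransform, hsum ht, hneg] using h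

theorem card_dvd_charTransform_correlation [Finite K] (hf : IsDifferenceBalanced n f) (he : e ≠ 1)
    {χ : Kˣ →* R} (hχ : χ ≠ 1) {π : R} (hπ : Prime π) {m : ℕ} (hcard : (Nat.card K : R) ∣ π ^ m)
    {σ : R →+* R} (hσπ : π ∣ σ π) (hσe : ∀ c, σ (e c) = e (t * c)) (hσχ : ∀ x, σ (χ x) = χ x) :
    (Nat.card K : R) ∣
      charTransform χ (correlation (fun x => e (t * f x)) (fun x => e (-f x))) := by
  have hprod := charTransform_mul_charTransform_inv hf he hχ
  have hdvd : charTransform χ (fun x => e (f x)) ∣ charTransform χ (fun x => e (t * f x)) := by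
    have hσ : σ (charTransform χ fun x => e (f x)) = charTransform χ fun x => e (t * f x) := by
      simp [charTransform, hσe, hσχ]
    exact hσ ▸ dvd_map_of_dvd_prime_pow hπ hσπ ((Dvd.intro _ hprod).trans hcard)
  rw [charTransform_correlation, ← hprod]
  exact mul_dvd_mul_right hdvd _

theorem card_dvd_correlation_add_one [Finite K] (hf : IsDifferenceBalanced n f)
    (hb : IsBalanced n f) (he : e ≠ 1) (ht : t ≠ 0)
    {θ : Kˣ →* R} (hθ : Function.Injective θ) {π : R} (hπ : Prime π) {m : ℕ}
    (hcard : (Nat.card K : R) ∣ π ^ m) {σ : R →+* R} (hσπ : π ∣ σ π)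
    (hσe : ∀ c, σ (e c) = e (t * c)) (hσθ : ∀ x, σ (θ x) = θ x) (a : Kˣ) :
    (Nat.card K : R) ∣ correlation (fun x => e (t * f x)) (fun x => e (-f x)) a + 1 := by
  set C := correlation (fun x => e (t * f x)) (fun x => e (-f x))
  have hq : (Fintype.card Kˣ : R) + 1 = Nat.card K := by
    rw [Nat.card_eq_card_units_add_one K, Nat.card_eq_fintype_card, Nat.cast_succ]
  have htransform (j : ℕ) : (Nat.card K : R) ∣ charTransform (θ ^ j) fun a => C a + 1 := by
    by_cases hχ : θ ^ j = 1
    · simp [hχ, charTransform, Finset.sum_add_distrib, C, hb.sum_correlation he ht, ← hq, add_comm]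
    · rw [charTransform_add_one hχ]
      exact card_dvd_charTransform_correlation hf he hχ hπ hcard hσπ hσe (by simp [hσθ])
  have hmul := dvd_card_mul_of_dvd_charTransform hθ htransform a
  have hsub : C a + 1 = Nat.card K * (C a + 1) - Fintype.card Kˣ * (C a + 1) := by
    rw [← hq]; ring
  exact hsub ▸ dvd_sub (dvd_mul_right _ _) hmul

end Correlation

section Multiplier

theorem forall_eq_or_exists_eq_of_forall_modEq {ι : Type*} [Fintype ι] {m : ι → ℕ} {q : ℕ}
    (hsum : ∑ i, m i = q) (h : ∀ i j, m i ≡ m j [MOD q]) :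
    (∀ i j, m i = m j) ∨ ∃ i, m i = q := by
  refine or_iff_not_imp_right.2 fun hne i j => ?_
  have hlt (i : ι) : m i < q :=
    lt_of_le_of_ne (hsum ▸ Finset.single_le_sum_of_canonicallyOrdered (Finset.mem_univ i))
      fun hi => hne ⟨i, hi⟩
  exact (h i j).eq_of_lt_of_lt (hlt i) (hlt j)

theorem isBalanced_of_fiberCount_eq {F K : Type*} [Field F] [Finite F] [Field K] [Finite K] {n : ℕ}
    (hn : n ≠ 0) (hK : Nat.card K = Nat.card F ^ n) {g : Kˣ → F}
    (h : ∀ c d, fiberCount g c = fiberCount g d) : IsBalanced n g := by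
  have := Fintype.ofFinite F
  refine isBalanced_iff_fiberCount.2 fun c => Nat.eq_of_mul_eq_mul_left (Nat.card_pos (α := F)) ?_
  calc Nat.card F * fiberCount g c = ∑ d, fiberCount g d := by
        simp [Finset.sum_congr rfl fun d _ => h d c]
    _ = Nat.card F * Nat.card F ^ (n - 1) := by rw [sum_fiberCount, hK, mul_pow_sub_one hn]

theorem injective_teichmuller {p : ℕ} [Fact p.Prime] {k : Type*} [CommRing k] :
    Function.Injective (WittVector.teichmuller p : k →* WittVector p k) := fun x y h => by
  simpa only [WittVector.teichmuller_coeff_zero] using congrArg (fun w => w.coeff 0) h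

open PrimeCyclotomicRing

variable {p n : ℕ} [Fact p.Prime] {K : Type*} [Field K] [Finite K]

theorem forall_eq_zero_or_isBalanced_of_dvd_sum_addChar [Fintype Kˣ] {W : Type*} [CommRing W]
    [IsDomain W] (hpW : Prime (p : W)) (hn : n ≠ 0) (hK : Nat.card K = p ^ n) {g : Kˣ → ZMod p}
    (hdvd : (Nat.card K : PrimeCyclotomicRing p W) ∣ ∑ x, addChar p W (g x) + 1) :
    (∀ x, g x = 0) ∨ IsBalanced n g := by
  have hsum : AdjoinRoot.of (Polynomial.cyclotomic p W) (Nat.card K) ∣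
      ∑ c, AdjoinRoot.of _ (fiberCount g c : W) * addChar p W c := by
    have h := sum_fiberCount_mul g (addChar p W)
    rw [AddChar.map_zero_eq_one] at h
    simpa only [map_natCast, h] using hdvd
  have hmod (c d : ZMod p) : fiberCount g c ≡ fiberCount g d [MOD Nat.card K] := by
    have h := dvd_sub_of_dvd_sum_mul_addChar hsum d c
    rw [Nat.modEq_iff_dvd, hK, Nat.cast_pow, ← pow_dvd_intCast_iff hpW]
    simpa [hK] using h
  obtain h | ⟨c, hc⟩ := forall_eq_or_exists_eq_of_forall_modEq (sum_fiberCount g) hmod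
  · exact .inr (isBalanced_of_fiberCount_eq hn (by rw [hK, Nat.card_zmod]) h)
  · exact .inl (eq_zero_of_fiberCount_eq_card hc)

variable {W : Type*} [CommRing W] [IsDomain W] [UniqueFactorizationMonoid W] {f : Kˣ → ZMod p}
  {θ : Kˣ →* W}

theorem card_dvd_correlation_addChar_add_one [Fintype Kˣ] (hpW : Prime (p : W))
    (hK : Nat.card K = p ^ n) (hf : IsDifferenceBalanced n f) (hb : IsBalanced n f)
    (hθ : Function.Injective θ) (t : (ZMod p)ˣ) (a : Kˣ) :
    (Nat.card K : PrimeCyclotomicRing p W) ∣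
      correlation (fun x => addChar p W (t * f x)) (fun x => addChar p W (-f x)) a + 1 := by
  have := isDomain hpW
  obtain ⟨σ, hσπ, hσe⟩ := exists_algHom_addChar_mul hpW t
  have hcard : (Nat.card K : PrimeCyclotomicRing p W) ∣ (AdjoinRoot.root _ - 1) ^ (p * n) := by
    rw [hK, Nat.cast_pow, pow_mul]
    exact pow_dvd_pow_of_dvd (natCast_dvd_sub_one_pow Fact.out root_pow_eq_one) n
  exact card_dvd_correlation_add_one (σ := σ)
    (θ := (algebraMap W (PrimeCyclotomicRing p W) : W →* PrimeCyclotomicRing p W).comp θ)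
    hf hb (addChar_ne_one hpW) t.ne_zero (of_injective.comp hθ) (prime_root_sub_one hpW) hcard
    hσπ hσe (fun x => σ.commutes _) a

theorem IsBalanced.exists_mul_comp_mul_left_eq_of_injective (hpW : Prime (p : W)) (hn : n ≠ 0)
    (hK : Nat.card K = p ^ n) (hb : IsBalanced n f) (hf : IsDifferenceBalanced n f)
    (hθ : Function.Injective θ) (t : (ZMod p)ˣ) : ∃ a : Kˣ, ∀ x, t * f (a * x) = f x := by
  have := Fintype.ofFinite Kˣ
  have := isDomain hpW
  have he := addChar_ne_one hpW
  by_contra! hne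
  have hcorr (a : Kˣ) :
      correlation (fun x => addChar p W (t * f x)) (fun x => addChar p W (-f x)) a = -1 := by
    have hdvd := card_dvd_correlation_addChar_add_one hpW hK hf hb hθ t a
    rw [correlation_addChar] at hdvd ⊢
    obtain ⟨x, hx⟩ := hne a
    have hdich := forall_eq_zero_or_isBalanced_of_dvd_sum_addChar hpW hn hK hdvd
    exact (hdich.resolve_left fun h => hx (sub_eq_zero.1 (h x))).sum_addChar he
  have hsum := hb.sum_correlation he t.ne_zero
  simp only [hcorr, Finset.sum_neg_distrib, Finset.sum_const, Finset.card_univ,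
    nsmul_eq_mul, mul_one] at hsum
  refine pow_ne_zero n (natCast_ne_zero (W := W) hpW.ne_zero) ?_
  rw [← Nat.cast_pow, ← hK, Nat.card_eq_card_units_add_one K, Nat.card_eq_fintype_card,
    Nat.cast_succ]
  linear_combination -hsum

theorem IsBalanced.exists_comp_mul_left_eq_mul [CharP K p] (hn : n ≠ 0) (hK : Nat.card K = p ^ n)
    (hb : IsBalanced n f) (hf : IsDifferenceBalanced n f) (t : (ZMod p)ˣ) :
    ∃ a : Kˣ, ∀ x, f (a * x) = t * f x := by
  obtain ⟨a, ha⟩ := hb.exists_mul_comp_mul_left_eq_of_injective (W := WittVector p K)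
    (θ := (WittVector.teichmuller p).comp (Units.coeHom K)) (WittVector.irreducible p).prime hn hK
    hf (injective_teichmuller.comp Units.val_injective) t⁻¹
  exact ⟨a, fun x => by rw [← ha x, Units.mul_inv_cancel_left]⟩

end Multiplier

section Homogeneous

variable {F K : Type*} [Field F] [Finite F] [Field K] {n : ℕ} {f : Kˣ → F}

theorem comp_pow_mul {G M : Type*} [Monoid G] [Monoid M] {f : G → M} {a : G} {t : M}
    (h : ∀ x, f (a * x) = t * f x) (k : ℕ) (x : G) : f (a ^ k * x) = t ^ k * f x := by
  induction k with
  | zero => simp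
  | succ k ih => rw [pow_succ', mul_assoc, h, ih, pow_succ', mul_assoc]

theorem IsBalanced.exists_ne_zero (hb : IsBalanced n f) : ∃ x, f x ≠ 0 := by
  have hcard : 0 < Nat.card {x // f x = 1} := by
    rw [hb.2 1 one_ne_zero]
    exact pow_pos Nat.card_pos _
  obtain ⟨⟨x, hx⟩⟩ := (Nat.card_pos_iff.1 hcard).1
  exact ⟨x, hx ▸ one_ne_zero⟩

theorem IsDifferenceBalanced.eq_one_of_comp_mul_left_eq (hf : IsDifferenceBalanced n f) {a : Kˣ}
    (ha : ∀ x, f (a * x) = f x) : a = 1 := by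
  by_contra h
  obtain ⟨x, hx⟩ := (hf a h).exists_ne_zero
  exact hx (sub_eq_zero.2 (ha x))

theorem IsDifferenceBalanced.orderOf_eq (hf : IsDifferenceBalanced n f) (hb : IsBalanced n f)
    {a : Kˣ} {t : Fˣ} (h : ∀ x, f (a * x) = t * f x) : orderOf a = orderOf t := by
  refine orderOf_eq_orderOf_iff.2 fun k => ⟨fun hk => ?_, fun hk => ?_⟩
  · obtain ⟨x, hx⟩ := hb.exists_ne_zero
    have hx' := comp_pow_mul h k x
    rw [hk, one_mul, right_eq_mul₀ hx] at hx'
    exact Units.ext (by simpa using hx')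
  · refine hf.eq_one_of_comp_mul_left_eq fun x => ?_
    rw [comp_pow_mul h, ← Units.val_pow_eq_pow_val, hk, Units.val_one, one_mul]

theorem IsDifferenceBalanced.exists_isHomogeneousOfDegree [Algebra F K]
    (hf : IsDifferenceBalanced n f) (hb : IsBalanced n f)
    (hmul : ∀ t : Fˣ, ∃ a : Kˣ, ∀ x, f (a * x) = t * f x) : ∃ d : ℤ, IsHomogeneousOfDegree d f := by
  let ι : Fˣ →* Kˣ := Units.map (algebraMap F K : F →* K)
  have hι : Function.Injective ι := Units.map_injective (algebraMap F K).injective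
  obtain ⟨g, hg⟩ := IsCyclic.exists_generator (α := Fˣ)
  obtain ⟨a, ha⟩ := hmul g
  have horder : orderOf a = Nat.card Fˣ :=
    (hf.orderOf_eq hb ha).trans (orderOf_eq_card_of_forall_mem_zpowers hg)
  have : NeZero (orderOf a) := ⟨horder ▸ Nat.card_pos.ne'⟩
  have hprim : IsPrimitiveRoot (a : K) (orderOf a) :=
    IsPrimitiveRoot.coe_units_iff.2 (IsPrimitiveRoot.orderOf a)
  have hιg : IsPrimitiveRoot (ι g : K) (orderOf a) := by
    rw [hf.orderOf_eq hb ha, ← orderOf_injective ι hι]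
    exact IsPrimitiveRoot.coe_units_iff.2 (IsPrimitiveRoot.orderOf (ι g))
  obtain ⟨d, -, hd, had⟩ := hprim.isPrimitiveRoot_iff.1 hιg
  have had : a ^ d = ι g := Units.ext (by rw [Units.val_pow_eq_pow_val, had])
  refine ⟨d, ?_, fun u x => ?_⟩
  · rw [horder, Nat.card_units] at hd
    rwa [← Nat.cast_pred Nat.card_pos, Int.gcd_natCast_natCast]
  · obtain ⟨m, rfl⟩ := (mem_powers_iff_mem_zpowers).2 (hg u)
    change f (ι (g ^ m) * x) = _
    rw [map_pow, ← had, ← pow_mul, comp_pow_mul ha, zpow_natCast, Units.val_pow_eq_pow_val,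
      ← pow_mul, mul_comm d]

end Homogeneous

section Translate

theorem exists_eq_single_neg_one {ι : Type*} [Fintype ι] [DecidableEq ι] {e : ι → ℤ}
    (hsum : ∑ i, e i = -1) (hsq : ∑ i, e i ^ 2 = 1) : ∃ b, e = Pi.single b (-1) := by
  obtain ⟨b, -, hb⟩ : ∃ b ∈ Finset.univ, e b ≠ 0 :=
    Finset.exists_ne_zero_of_sum_ne_zero (by rw [hsum]; decide)
  have hzero (i : ι) (hi : i ≠ b) : e i = 0 := by
    have hle := Finset.sum_le_univ_sum_of_nonneg (s := {i, b}) fun i => sq_nonneg (e i)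
    rw [Finset.sum_pair hi, hsq] at hle
    have hb1 : 1 ≤ e b ^ 2 := Int.add_one_le_iff.2 (sq_pos_of_ne_zero hb)
    exact sq_eq_zero_iff.1 (le_antisymm (by linarith) (sq_nonneg _))
  have heb : e b = -1 := hsum ▸ (Fintype.sum_eq_single b hzero).symm
  refine ⟨b, funext fun i => ?_⟩
  obtain rfl | hi := eq_or_ne i b
  · rw [Pi.single_eq_same, heb]
  · rw [Pi.single_eq_of_ne hi, hzero i hi]

theorem sum_card_fiber_sq_eq {G κ : Type*} [Group G] [Fintype G] [Fintype κ] (f : G → κ) :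
    ∑ c, Nat.card {x // f x = c} ^ 2 = ∑ a, Nat.card {x // f (a * x) = f x} := by
  classical
  calc ∑ c, Nat.card {x // f x = c} ^ 2 = ∑ x, Nat.card {y // f y = f x} := by
        simpa [sq] using sum_card_fiber_mul f fun c => Nat.card {x // f x = c}
    _ = ∑ x, ∑ a, if f (a * x) = f x then 1 else 0 := by
        refine Finset.sum_congr rfl fun x _ => ?_
        rw [Nat.card_eq_fintype_card, Fintype.card_subtype, Finset.card_filter,
          ← Equiv.sum_comp (Equiv.mulRight x)]
        rfl
    _ = ∑ a, Nat.card {x // f (a * x) = f x} := by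
        rw [Finset.sum_comm]
        simp only [Nat.card_eq_fintype_card, Fintype.card_subtype, Finset.card_filter]

theorem exists_eq_add_single_neg_one {ι : Type*} [Fintype ι] [DecidableEq ι] {N : ι → ℤ} {Q : ℤ}
    (hsum : ∑ i, N i = Fintype.card ι * Q - 1)
    (hsq : ∑ i, N i ^ 2 = 1 + (Fintype.card ι * Q - 2) * Q) :
    ∃ b, ∀ i, N i = Q + Pi.single (M := fun _ => ℤ) b (-1) i := by
  obtain ⟨b, hb⟩ := exists_eq_single_neg_one (e := fun i => N i - Q)
    (by simp [hsum])
    (by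
      simp only [sub_sq, Finset.sum_add_distrib, Finset.sum_sub_distrib, ← Finset.sum_mul,
        ← Finset.mul_sum, hsum, hsq, Finset.sum_const, Finset.card_univ, nsmul_eq_mul]
      ring)
  exact ⟨b, fun i => by rw [← hb]; ring⟩

variable {F K : Type*} [Field F] [Field K] {n : ℕ} {f : Kˣ → F}

theorem IsDifferenceBalanced.sub_const (hf : IsDifferenceBalanced n f) (b : F) :
    IsDifferenceBalanced n fun x => f x - b := by
  intro a ha
  simpa only [sub_sub_sub_cancel_right] using hf a ha

theorem IsDifferenceBalanced.sum_card_fiber_sq [Fintype F] [Finite K]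
    (hf : IsDifferenceBalanced n f) :
    ∑ c, (Nat.card {x // f x = c} : ℤ) ^ 2 =
      1 + (Nat.card K - 2) * (Nat.card F : ℤ) ^ (n - 1) := by
  classical
  have := Fintype.ofFinite Kˣ
  have hcard : (Fintype.card Kˣ : ℤ) = Nat.card K - 1 := by
    rw [Nat.card_eq_card_units_add_one K, Nat.card_eq_fintype_card]
    simp
  have hfiber (a : Kˣ) : (Nat.card {x // f (a * x) = f x} : ℤ) =
      (Nat.card F : ℤ) ^ (n - 1) - 1 +
        if a = 1 then Nat.card K - (Nat.card F : ℤ) ^ (n - 1) else 0 := by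
    split_ifs with ha
    · simp [ha, hcard]
    · have h := isBalanced_iff_fiberCount.1 (hf a ha) 0
      simp only [fiberCount, if_true, sub_eq_zero] at h
      rw [← Nat.cast_pow, ← h, Nat.cast_succ, add_sub_cancel_right, add_zero]
  calc ∑ c, (Nat.card {x // f x = c} : ℤ) ^ 2
      = ∑ a, (Nat.card {x // f (a * x) = f x} : ℤ) := by
        exact_mod_cast sum_card_fiber_sq_eq f
    _ = (Nat.card K - 1) * ((Nat.card F : ℤ) ^ (n - 1) - 1) +
          (Nat.card K - (Nat.card F : ℤ) ^ (n - 1)) := by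
        simp only [hfiber, Finset.sum_add_distrib, Finset.sum_const, Finset.card_univ,
          nsmul_eq_mul, hcard, Fintype.sum_ite_eq']
    _ = 1 + (Nat.card K - 2) * (Nat.card F : ℤ) ^ (n - 1) := by ring

theorem IsDifferenceBalanced.exists_isBalanced_sub [Finite F] [Finite K] (hn : n ≠ 0)
    (hK : Nat.card K = Nat.card F ^ n) (hf : IsDifferenceBalanced n f) :
    ∃ b, IsBalanced n fun x => f x - b := by
  classical
  have := Fintype.ofFinite F
  have := Fintype.ofFinite Kˣ
  have hcard : (Nat.card K : ℤ) = Fintype.card F * (Nat.card F : ℤ) ^ (n - 1) := by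
    rw [hK, Nat.cast_pow, ← Nat.card_eq_fintype_card, mul_pow_sub_one hn]
  have hsum : ∑ c, (Nat.card {x // f x = c} : ℤ) = Nat.card K - 1 := by
    have h := sum_card_fiber_mul (R := ℤ) f fun _ => 1
    simp only [mul_one, Finset.sum_const, Finset.card_univ, nsmul_eq_mul] at h
    rw [h, Nat.card_eq_card_units_add_one K, Nat.card_eq_fintype_card, Nat.cast_succ,
      add_sub_cancel_right]
  obtain ⟨b, hb⟩ := exists_eq_add_single_neg_one (hcard ▸ hsum) (hcard ▸ hf.sum_card_fiber_sq)
  refine ⟨b, isBalanced_iff_fiberCount.2 fun c => ?_⟩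
  have hcb := hb (c + b)
  simp only [Pi.single_apply, add_eq_right] at hcb
  simp only [fiberCount, sub_eq_iff_eq_add]
  split_ifs at hcb ⊢ <;> · zify; linarith

end Translate

theorem theorem5p3 (p n : ℕ) [Fact p.Prime] (K : Type*) [Field K] [Algebra (ZMod p) K]
    (hK : Nat.card K = p ^ n) (f : Kˣ → ZMod p) (hf : IsDifferenceBalanced n f) :
    (IsBalanced n f → ∃ d : ℤ, IsHomogeneousOfDegree d f) ∧
      ∃ b : ZMod p, IsBalanced n (fun x : Kˣ => f x - b) ∧
        ∃ d : ℤ, IsHomogeneousOfDegree d (fun x : Kˣ => f x - b) := by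
  have hfin : Finite K :=
    Nat.finite_of_card_ne_zero (hK ▸ pow_ne_zero n (Fact.out : p.Prime).ne_zero)
  have hn : n ≠ 0 := by
    rintro rfl
    exact Finite.one_lt_card.ne' hK
  have : CharP K p := charP_of_injective_algebraMap (algebraMap (ZMod p) K).injective p
  have hhom {g : Kˣ → ZMod p} (hg : IsDifferenceBalanced n g) (hb : IsBalanced n g) :
      ∃ d : ℤ, IsHomogeneousOfDegree d g :=
    hg.exists_isHomogeneousOfDegree hb (hb.exists_comp_mul_left_eq_mul hn hK hg)
  obtain ⟨b, hb⟩ := hf.exists_isBalanced_sub hn (by rw [hK, Nat.card_zmod])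
  exact ⟨hhom hf, b, hb, hhom (hf.sub_const b) hb⟩
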